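/- Let $Y_1,Y_2,\dots$ be i.i.d. real random variables such that $P(|Y_1|>x)\sim \ell(x)\,x^{-\alpha}$ as $x\to\infty$, where $\alpha\in(0,2)$ and $\ell$ is slowly varying at infinity, i.e. $\ell$ is positive and measurable on some half-line $[X,\infty)$ and $\ell(cx)/\ell(x)\to1$ as $x\to\infty$ for every $c>0$. Put $V_n=\sqrt{Y_1^2+\cdots+Y_n^2}$ and $\delta_{1,n}=Y_1/V_n$ (with $\delta_{1,n}=0$ where $V_n=0$). Then for every real $\gamma>1$ the moments $E|\delta_{1,n}|^{2\gamma}$ are finite and $$ \lim_{n\to\infty} n\,E|\delta_{1,n}|^{2\gamma}=\frac{\Gamma(\gamma-\alpha/2)}{\Gamma(\gamma)\,\Gamma(1-\alpha/2)}, $$ where $\Gamma$ is Euler's gamma function. -/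

import Mathlib

open Filter Topology MeasureTheory ProbabilityTheory Asymptotics

/-- `ℓ` is slowly varying at `∞`: it is positive and measurable on some half-line `[X, ∞)`, and
`ℓ (c * x) / ℓ x → 1` as `x → ∞` for every `c > 0`. -/
def SlowlyVarying (ℓ : ℝ → ℝ) : Prop :=
  (∃ X : ℝ, (∀ x, X ≤ x → 0 < ℓ x) ∧ Measurable (fun x : Set.Ici X => ℓ x)) ∧
    ∀ c : ℝ, 0 < c → Tendsto (fun x => ℓ (c * x) / ℓ x) atTop (𝓝 1)

/-- The self-normalizer `V_n = √(Y_1² + ⋯ + Y_n²)`. Sequences are indexed from `0`, so that the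
first `n` variables are `Y 0, …, Y (n - 1)`. -/
noncomputable def selfNormalizer {Ω : Type*} (Y : ℕ → Ω → ℝ) (n : ℕ) (ω : Ω) : ℝ :=
  Real.sqrt (∑ i ∈ Finset.range n, Y i ω ^ 2)

/-- The normalized variable `Y k / V_n`, equal to `0` where `V_n = 0`. With sequences indexed from
`0`, the variable written `δ_{1,n} = Y_1 / V_n` is `selfNormalized Y 0 n`. -/
noncomputable def selfNormalized {Ω : Type*} (Y : ℕ → Ω → ℝ) (k n : ℕ) (ω : Ω) : ℝ :=
  Y k ω / selfNormalizer Y n ω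

/-!
For nonnegative i.i.d. `X i` with sum `S` over `n` indices and Laplace transform
`φ s = E[exp (-s * X 0)]`, integrating `exp (-s * S)` against `s ^ (γ - 1)` and using independence
gives
`Γ(γ) * E[(X 0 / S) ^ γ] =`
`∫ s in (0, ∞), s ^ (γ - 1) * E[X 0 ^ γ * exp (-s * X 0)] * φ s ^ (n - 1)`.
The measures `n * φ ^ (n - 1) * (-φ') ds` have total mass tending to one and concentrate at `0`, so
only the behaviour at `0` of the quotient of `s ^ (γ - 1) * E[X 0 ^ γ * exp (-s * X 0)]` by
`-φ' s = E[X 0 * exp (-s * X 0)]` matters. If the tail of `X 0` is regularly varying of index `-β`,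
an Abelian theorem, proved by dominated convergence with Potter's bound, shows that this quotient
tends to `Γ(γ - β) / Γ(1 - β)`. The squares `X i = Y i ^ 2` have `β = α / 2`.
-/

/-- Regular variation of `f` with index `ρ` at `∞`. No measurability is imposed: the functions of
interest here are antitone. -/
structure RegularlyVarying (f : ℝ → ℝ) (ρ : ℝ) : Prop where
  eventually_pos : ∀ᶠ x in atTop, 0 < f x
  tendsto_div : ∀ c, 0 < c → Tendsto (fun x => f (c * x) / f x) atTop (𝓝 (c ^ ρ))

theorem SlowlyVarying.regularlyVarying_mul_rpow {ℓ : ℝ → ℝ} (hℓ : SlowlyVarying ℓ) (ρ : ℝ) :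
    RegularlyVarying (fun x => ℓ x * x ^ ρ) ρ where
  eventually_pos := by
    obtain ⟨⟨X, hX, -⟩, -⟩ := hℓ
    filter_upwards [eventually_ge_atTop X, eventually_gt_atTop 0] with x hx hx0
    exact mul_pos (hX x hx) (Real.rpow_pos_of_pos hx0 _)
  tendsto_div c hc := by
    have h := (hℓ.2 c hc).mul_const (c ^ ρ)
    rw [one_mul] at h
    refine h.congr' ?_
    filter_upwards [eventually_gt_atTop 0] with x hx
    have hxρ : x ^ ρ ≠ 0 := (Real.rpow_pos_of_pos hx _).ne'
    rw [Real.mul_rpow hc.le hx.le, ← mul_assoc, mul_div_mul_right _ _ hxρ, div_mul_eq_mul_div]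

namespace RegularlyVarying

variable {f g : ℝ → ℝ} {β ρ : ℝ}

theorem congr_isEquivalent (hf : RegularlyVarying f ρ) (hgf : g ~[atTop] f) :
    RegularlyVarying g ρ where
  eventually_pos := by
    have hquot := (isEquivalent_iff_tendsto_one (hf.eventually_pos.mono fun _ h => h.ne')).1 hgf
    filter_upwards [hquot.eventually (lt_mem_nhds one_pos), hf.eventually_pos] with x hx hfx
    exact (div_pos_iff_of_pos_right hfx).1 hx
  tendsto_div c hc :=
    ((hgf.comp_tendsto (tendsto_id.const_mul_atTop hc)).div hgf).symm.tendsto_nhds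
      (hf.tendsto_div c hc)

theorem comp_rpow (hf : RegularlyVarying f ρ) {p : ℝ} (hp : 0 < p) :
    RegularlyVarying (fun x => f (x ^ p)) (p * ρ) where
  eventually_pos := (tendsto_rpow_atTop hp).eventually hf.eventually_pos
  tendsto_div c hc := by
    have h := (hf.tendsto_div (c ^ p) (Real.rpow_pos_of_pos hc p)).comp (tendsto_rpow_atTop hp)
    rw [← Real.rpow_mul hc.le] at h
    refine h.congr' ?_
    filter_upwards [eventually_ge_atTop 0] with x hx
    rw [Function.comp_apply, Real.mul_rpow hc.le hx]

theorem pos_of_antitone (hf : RegularlyVarying f ρ) (hanti : Antitone f) (x : ℝ) : 0 < f x := by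
  obtain ⟨y, hy, hxy⟩ := (hf.eventually_pos.and (eventually_ge_atTop x)).exists
  exact hy.trans_le (hanti hxy)

theorem eventually_le_two_rpow_mul (hf : RegularlyVarying f (-β)) (hβρ : β < ρ) :
    ∀ᶠ x in atTop, f x ≤ 2 ^ ρ * f (2 * x) := by
  have hlt : (2 : ℝ) ^ (-ρ) < 2 ^ (-β) :=
    Real.rpow_lt_rpow_of_exponent_lt one_lt_two (neg_lt_neg hβρ)
  filter_upwards [(hf.tendsto_div 2 two_pos).eventually (lt_mem_nhds hlt), hf.eventually_pos]
    with x hx hfx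
  rw [lt_div_iff₀ hfx, Real.rpow_neg two_pos.le, inv_mul_lt_iff₀ (by positivity)] at hx
  exact hx.le

end RegularlyVarying

theorem le_pow_mul_comp_two_pow_mul {f : ℝ → ℝ} {x₀ K : ℝ} (hK : 0 ≤ K) (hx₀ : 0 ≤ x₀)
    (hdouble : ∀ y, x₀ ≤ y → f y ≤ K * f (2 * y)) {y : ℝ} (hy : x₀ ≤ y) (k : ℕ) :
    f y ≤ K ^ k * f (2 ^ k * y) := by
  induction k with
  | zero => simp
  | succ k ih =>
    have hle : x₀ ≤ 2 ^ k * y :=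
      hy.trans (le_mul_of_one_le_left (hx₀.trans hy) (one_le_pow₀ one_le_two))
    calc f y ≤ K ^ k * f (2 ^ k * y) := ih
      _ ≤ K ^ k * (K * f (2 * (2 ^ k * y))) := by gcongr; exact hdouble _ hle
      _ = K ^ (k + 1) * f (2 ^ (k + 1) * y) := by ring_nf

theorem le_two_mul_div_rpow_mul_of_antitone {f : ℝ → ℝ} (hanti : Antitone f) (hf : ∀ x, 0 ≤ f x)
    {x₀ ρ : ℝ} (hρ : 0 ≤ ρ) (hx₀ : 0 < x₀) (hdouble : ∀ y, x₀ ≤ y → f y ≤ 2 ^ ρ * f (2 * y))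
    {x y : ℝ} (hy : x₀ ≤ y) (hyx : y ≤ x) : f y ≤ (2 * (x / y)) ^ ρ * f x := by
  have hy0 : 0 < y := hx₀.trans_le hy
  obtain ⟨k, hk, hk'⟩ := exists_nat_pow_near ((one_le_div hy0).2 hyx) one_lt_two
  calc f y ≤ ((2 : ℝ) ^ ρ) ^ (k + 1) * f (2 ^ (k + 1) * y) :=
        le_pow_mul_comp_two_pow_mul (by positivity) hx₀.le hdouble hy (k + 1)
    _ = (2 * 2 ^ k) ^ ρ * f (2 ^ (k + 1) * y) := by
        rw [Real.rpow_pow_comm two_pos.le, pow_succ']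
    _ ≤ (2 * (x / y)) ^ ρ * f x := by
        have hxk : x ≤ 2 ^ (k + 1) * y := ((div_lt_iff₀ hy0).1 hk').le
        exact mul_le_mul (by gcongr) (hanti hxk) (hf _) (by have := hy0.le.trans hyx; positivity)

namespace RegularlyVarying

variable {f k : ℝ → ℝ} {β ρ : ℝ}

theorem exists_comp_mul_le_rpow_mul (hf : RegularlyVarying f (-β)) (hanti : Antitone f)
    (hρ : 0 ≤ ρ) (hβρ : β < ρ) :
    ∃ C, 0 ≤ C ∧ ∀ᶠ x in atTop, ∀ u, 0 < u → u ≤ 1 → f (u * x) ≤ C * u ^ (-ρ) * f x := by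
  have hpos := hf.pos_of_antitone hanti
  obtain ⟨a, ha⟩ := eventually_atTop.1 (hf.eventually_le_two_rpow_mul hβρ)
  set x₀ := max a 1
  have hx₀ : 0 < x₀ := one_pos.trans_le (le_max_right a 1)
  have hC : 0 ≤ f 0 / f x₀ := (div_pos (hpos _) (hpos _)).le
  refine ⟨f 0 / f x₀ * 2 ^ ρ, by positivity, ?_⟩
  filter_upwards [eventually_ge_atTop x₀] with x hx u hu hu1
  have hx0 : 0 < x := hx₀.trans_le hx
  -- Doubling controls `f` on `[x₀, ∞)`; on `(0, x₀]` we have `f ≤ f 0`.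
  set z := max (u * x) x₀
  have hz : 0 < z := hx₀.trans_le (le_max_right _ _)
  have hux : f (u * x) ≤ f 0 / f x₀ * f z := by
    rcases le_total x₀ (u * x) with h | h
    · rw [show z = u * x from max_eq_left h]
      exact le_mul_of_one_le_left (hpos _).le ((one_le_div (hpos _)).2 (hanti hx₀.le))
    · rw [show z = x₀ from max_eq_right h, div_mul_cancel₀ _ (hpos _).ne']
      exact hanti (by positivity)
  have hfz : f z ≤ (2 * (x / z)) ^ ρ * f x :=
    le_two_mul_div_rpow_mul_of_antitone hanti (fun y => (hpos y).le) hρ hx₀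
      (fun y hy => ha y ((le_max_left a 1).trans hy)) (le_max_right _ _)
      (max_le (mul_le_of_le_one_left hx0.le hu1) hx)
  have hxz : x / z ≤ u⁻¹ := by
    rw [div_le_iff₀ hz, le_inv_mul_iff₀ hu]
    exact le_max_left _ _
  calc f (u * x) ≤ f 0 / f x₀ * f z := hux
    _ ≤ f 0 / f x₀ * ((2 * u⁻¹) ^ ρ * f x) := by
      have := hpos x
      gcongr
      exact hfz.trans (by gcongr)
    _ = f 0 / f x₀ * 2 ^ ρ * u ^ (-ρ) * f x := by
      rw [Real.mul_rpow two_pos.le (by positivity), Real.inv_rpow hu.le, ← Real.rpow_neg hu.le]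
      ring

theorem exists_potter_bound (hf : RegularlyVarying f (-β)) (hanti : Antitone f) (hρ : 0 ≤ ρ)
    (hβρ : β < ρ) :
    ∃ C, ∀ᶠ x in atTop, ∀ u, 0 < u → f (u * x) ≤ (C * u ^ (-ρ) + 1) * f x := by
  obtain ⟨C, hC, hbound⟩ := hf.exists_comp_mul_le_rpow_mul hanti hρ hβρ
  refine ⟨C, ?_⟩
  filter_upwards [hbound, eventually_ge_atTop 0] with x hx hx0 u hu
  have hfx : 0 ≤ f x := (hf.pos_of_antitone hanti x).le
  rw [add_mul, one_mul]
  rcases le_total u 1 with hu1 | hu1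
  · exact (hx u hu hu1).trans (le_add_of_nonneg_right hfx)
  · exact (hanti (le_mul_of_one_le_left hx0 hu1)).trans (le_add_of_nonneg_left (by positivity))

theorem tendsto_integral_comp_mul_div (hf : RegularlyVarying f (-β)) (hanti : Antitone f)
    (hρ : 0 ≤ ρ) (hβρ : β < ρ) (hk : IntegrableOn k (Set.Ioi 0))
    (hkρ : IntegrableOn (fun u => u ^ (-ρ) * k u) (Set.Ioi 0)) :
    Tendsto (fun x => (∫ u in Set.Ioi 0, f (u * x) * k u) / f x) atTop
      (𝓝 (∫ u in Set.Ioi 0, u ^ (-β) * k u)) := by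
  have hpos := hf.pos_of_antitone hanti
  obtain ⟨C, hC⟩ := hf.exists_potter_bound hanti hρ hβρ
  have hlim : Tendsto (fun x => ∫ u in Set.Ioi 0, f (u * x) / f x * k u) atTop
      (𝓝 (∫ u in Set.Ioi 0, u ^ (-β) * k u)) := by
    refine tendsto_integral_filter_of_dominated_convergence
      (fun u => C * ‖u ^ (-ρ) * k u‖ + ‖k u‖) (Eventually.of_forall fun x => ?_) ?_
      ((hkρ.norm.const_mul C).add hk.norm) ?_
    · have hmeas : Measurable fun u => f (u * x) / f x :=
        (hanti.measurable.comp (measurable_id.mul_const x)).div_const _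
      exact hmeas.aestronglyMeasurable.mul hk.aestronglyMeasurable
    · filter_upwards [hC] with x hx
      filter_upwards [ae_restrict_mem measurableSet_Ioi] with u (hu : 0 < u)
      calc ‖f (u * x) / f x * k u‖ = f (u * x) / f x * ‖k u‖ := by
            rw [norm_mul, Real.norm_of_nonneg (div_pos (hpos _) (hpos _)).le]
        _ ≤ (C * u ^ (-ρ) + 1) * ‖k u‖ := by
            gcongr
            exact (div_le_iff₀ (hpos x)).2 (hx u hu)
        _ = C * ‖u ^ (-ρ) * k u‖ + ‖k u‖ := by
            rw [norm_mul, Real.norm_of_nonneg (Real.rpow_nonneg hu.le _)]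
            ring
    · filter_upwards [ae_restrict_mem measurableSet_Ioi] with u hu
      exact (hf.tendsto_div u hu).mul_const _
  refine hlim.congr fun x => ?_
  rw [← integral_div]
  simp only [div_mul_eq_mul_div]

end RegularlyVarying

/-- The derivative of `u ↦ u ^ γ * exp (-u)` on `(0, ∞)`. -/
noncomputable def rpowMulExpNegDeriv (γ u : ℝ) : ℝ :=
  (γ * u ^ (γ - 1) - u ^ γ) * Real.exp (-u)

theorem hasDerivAt_rpow_mul_exp_neg (γ : ℝ) {u : ℝ} (hu : 0 < u) :
    HasDerivAt (fun u : ℝ => u ^ γ * Real.exp (-u)) (rpowMulExpNegDeriv γ u) u := by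
  refine ((Real.hasDerivAt_rpow_const (Or.inl hu.ne')).mul (hasDerivAt_neg u).exp).congr_deriv ?_
  rw [rpowMulExpNegDeriv]
  ring

theorem rpow_neg_mul_rpowMulExpNegDeriv (γ ρ : ℝ) {u : ℝ} (hu : 0 < u) :
    u ^ (-ρ) * rpowMulExpNegDeriv γ u =
      γ * (Real.exp (-u) * u ^ ((γ - ρ) - 1)) - Real.exp (-u) * u ^ ((γ - ρ + 1) - 1) := by
  have hpred : u ^ ((γ - ρ) - 1) = u ^ (-ρ) * u ^ (γ - 1) := by
    rw [← Real.rpow_add hu]; ring_nf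
  have hself : u ^ ((γ - ρ + 1) - 1) = u ^ (-ρ) * u ^ γ := by
    rw [← Real.rpow_add hu]; ring_nf
  rw [hpred, hself, rpowMulExpNegDeriv]
  ring

theorem integrableOn_rpow_neg_mul_rpowMulExpNegDeriv {γ ρ : ℝ} (hργ : ρ < γ) :
    IntegrableOn (fun u => u ^ (-ρ) * rpowMulExpNegDeriv γ u) (Set.Ioi 0) := by
  refine IntegrableOn.congr_fun ?_
    (fun u hu => (rpow_neg_mul_rpowMulExpNegDeriv γ ρ hu).symm) measurableSet_Ioi
  exact ((Real.GammaIntegral_convergent (by linarith)).const_mul γ).sub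
    (Real.GammaIntegral_convergent (by linarith))

theorem integrableOn_rpowMulExpNegDeriv {γ : ℝ} (hγ : 0 < γ) :
    IntegrableOn (rpowMulExpNegDeriv γ) (Set.Ioi 0) := by
  simpa using integrableOn_rpow_neg_mul_rpowMulExpNegDeriv hγ

theorem integral_rpow_neg_mul_rpowMulExpNegDeriv {γ ρ : ℝ} (hργ : ρ < γ) :
    ∫ u in Set.Ioi 0, u ^ (-ρ) * rpowMulExpNegDeriv γ u = ρ * Real.Gamma (γ - ρ) := by
  have hpos : 0 < γ - ρ := sub_pos.2 hργ
  rw [setIntegral_congr_fun measurableSet_Ioi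
      fun u hu => rpow_neg_mul_rpowMulExpNegDeriv γ ρ hu,
    integral_sub ((Real.GammaIntegral_convergent hpos).const_mul γ)
      (Real.GammaIntegral_convergent (by linarith)), integral_const_mul,
    ← Real.Gamma_eq_integral hpos, ← Real.Gamma_eq_integral (by linarith),
    Real.Gamma_add_one hpos.ne']
  ring

theorem intervalIntegral_rpowMulExpNegDeriv {γ v : ℝ} (hγ : 0 < γ) (hv : 0 ≤ v) :
    ∫ u in 0..v, rpowMulExpNegDeriv γ u = v ^ γ * Real.exp (-v) := by
  have hcont : Continuous fun u : ℝ => u ^ γ * Real.exp (-u) :=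
    (Real.continuous_rpow_const hγ.le).mul (by fun_prop)
  rw [intervalIntegral.integral_eq_sub_of_hasDerivAt_of_le hv hcont.continuousOn
      fun u hu => hasDerivAt_rpow_mul_exp_neg γ hu.1, Real.zero_rpow hγ.ne', zero_mul, sub_zero]
  exact (intervalIntegrable_iff_integrableOn_Ioc_of_le hv).2
    ((integrableOn_rpowMulExpNegDeriv hγ).mono_set Set.Ioc_subset_Ioi_self)

section TailProb

variable {Ω : Type*} [MeasurableSpace Ω] {P : Measure Ω} {X : Ω → ℝ}

/-- The tail `x ↦ P(X > x)` of the random variable `X`. -/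
noncomputable def tailProb (P : Measure Ω) (X : Ω → ℝ) (x : ℝ) : ℝ :=
  P.real {ω | x < X ω}

theorem antitone_tailProb [IsFiniteMeasure P] (X : Ω → ℝ) : Antitone (tailProb P X) :=
  fun _ _ hab => measureReal_mono fun _ hω => lt_of_le_of_lt hab hω

theorem tailProb_const_mul (X : Ω → ℝ) {s : ℝ} (hs : 0 < s) (u : ℝ) :
    tailProb P (fun ω => s * X ω) u = tailProb P X (u * s⁻¹) := by
  simp only [tailProb, ← div_eq_mul_inv, div_lt_iff₀' hs]

theorem integral_intervalIntegral_eq_integral_tailProb_mul [IsFiniteMeasure P]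
    (hX : AEMeasurable X P) (hX0 : 0 ≤ᵐ[P] X) {f : ℝ → ℝ} (hf : IntegrableOn f (Set.Ioi 0)) :
    ∫ ω, (∫ u in 0..X ω, f u) ∂P = ∫ u in Set.Ioi 0, tailProb P X u * f u := by
  have hbelow : NullMeasurableSet {p : Ω × ℝ | p.2 < X p.1}
      (P.prod (volume.restrict (Set.Ioi 0))) :=
    nullMeasurableSet_lt measurable_snd.aemeasurable hX.comp_fst
  have hint : Integrable (Function.uncurry fun ω u => (Set.Iio (X ω)).indicator f u)
      (P.prod (volume.restrict (Set.Ioi 0))) :=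
    (hf.comp_snd P).indicator₀ hbelow
  calc ∫ ω, (∫ u in 0..X ω, f u) ∂P
      = ∫ ω, (∫ u in Set.Ioi 0, (Set.Iio (X ω)).indicator f u) ∂P := by
        refine integral_congr_ae ?_
        filter_upwards [hX0] with ω (hω : 0 ≤ X ω)
        rw [setIntegral_indicator measurableSet_Iio, Set.Ioi_inter_Iio,
          intervalIntegral.integral_of_le hω, integral_Ioc_eq_integral_Ioo]
    _ = ∫ u in Set.Ioi 0, ∫ ω, (Set.Iio (X ω)).indicator f u ∂P := integral_integral_swap hint
    _ = ∫ u in Set.Ioi 0, tailProb P X u * f u := by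
        congr with u
        have hsection : (fun ω => (Set.Iio (X ω)).indicator f u) =
            {ω | u < X ω}.indicator fun _ => f u := rfl
        rw [hsection, integral_indicator₀ (nullMeasurableSet_lt aemeasurable_const hX),
          setIntegral_const, smul_eq_mul, tailProb]

end TailProb

section DampedMoment

variable {Ω : Type*} [MeasurableSpace Ω] {P : Measure Ω} {X : Ω → ℝ} {β γ s : ℝ}

/-- The exponentially damped moment `E[X ^ γ * exp (-s X)]`. For `γ = 1` it is minus the derivative
of the Laplace transform `s ↦ mgf X P (-s)`. -/
noncomputable def dampedMoment (P : Measure Ω) (X : Ω → ℝ) (γ s : ℝ) : ℝ :=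
  ∫ ω, X ω ^ γ * Real.exp (-(s * X ω)) ∂P

theorem rpow_mul_dampedMoment_eq_integral_tailProb [IsFiniteMeasure P] (hX : AEMeasurable X P)
    (hX0 : 0 ≤ᵐ[P] X) (hγ : 0 < γ) (hs : 0 < s) :
    s ^ γ * dampedMoment P X γ s =
      ∫ u in Set.Ioi 0, tailProb P X (u * s⁻¹) * rpowMulExpNegDeriv γ u := by
  have hsX0 : 0 ≤ᵐ[P] fun ω => s * X ω := hX0.mono fun ω hω => mul_nonneg hs.le hω
  simp only [← tailProb_const_mul X hs]
  rw [← integral_intervalIntegral_eq_integral_tailProb_mul (hX.const_mul s) hsX0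
    (integrableOn_rpowMulExpNegDeriv hγ), dampedMoment, ← integral_const_mul]
  refine integral_congr_ae ?_
  filter_upwards [hX0, hsX0] with ω hω hsω
  rw [intervalIntegral_rpowMulExpNegDeriv hγ hsω, Real.mul_rpow hs.le hω, mul_assoc]

theorem tendsto_rpow_mul_dampedMoment_div_tailProb [IsFiniteMeasure P] (hX : AEMeasurable X P)
    (hX0 : 0 ≤ᵐ[P] X) (hβ : 0 ≤ β) (hβγ : β < γ) (htail : RegularlyVarying (tailProb P X) (-β)) :
    Tendsto (fun s => s ^ γ * dampedMoment P X γ s / tailProb P X s⁻¹) (𝓝[>] 0)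
      (𝓝 (β * Real.Gamma (γ - β))) := by
  obtain ⟨ρ, hβρ, hργ⟩ := exists_between hβγ
  have hγ : 0 < γ := hβ.trans_lt hβγ
  have hlim := htail.tendsto_integral_comp_mul_div (antitone_tailProb X) (hβ.trans hβρ.le) hβρ
    (integrableOn_rpowMulExpNegDeriv hγ) (integrableOn_rpow_neg_mul_rpowMulExpNegDeriv hργ)
  rw [integral_rpow_neg_mul_rpowMulExpNegDeriv hβγ] at hlim
  refine (hlim.comp tendsto_inv_nhdsGT_zero).congr' ?_
  filter_upwards [self_mem_nhdsWithin] with s hs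
  rw [Function.comp_apply, rpow_mul_dampedMoment_eq_integral_tailProb hX hX0 hγ hs]

theorem tendsto_rpow_mul_dampedMoment_div_dampedMoment_one [IsFiniteMeasure P]
    (hX : AEMeasurable X P) (hX0 : 0 ≤ᵐ[P] X) (hβ : 0 < β) (hβ1 : β < 1) (hβγ : β < γ)
    (htail : RegularlyVarying (tailProb P X) (-β)) :
    Tendsto (fun s => s ^ (γ - 1) * dampedMoment P X γ s / dampedMoment P X 1 s) (𝓝[>] 0)
      (𝓝 (Real.Gamma (γ - β) / Real.Gamma (1 - β))) := by
  have hΓ : Real.Gamma (1 - β) ≠ 0 := (Real.Gamma_pos_of_pos (sub_pos.2 hβ1)).ne'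
  have hlim := (tendsto_rpow_mul_dampedMoment_div_tailProb hX hX0 hβ.le hβγ htail).div
    (tendsto_rpow_mul_dampedMoment_div_tailProb hX hX0 hβ.le hβ1 htail) (mul_ne_zero hβ.ne' hΓ)
  rw [mul_div_mul_left _ _ hβ.ne'] at hlim
  refine hlim.congr' ?_
  filter_upwards [self_mem_nhdsWithin] with s (hs : 0 < s)
  have htail0 := (htail.pos_of_antitone (antitone_tailProb X) s⁻¹).ne'
  rw [Pi.div_apply, div_div_div_cancel_right₀ htail0, Real.rpow_one, Real.rpow_sub_one hs.ne']
  field_simp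

end DampedMoment

theorem setIntegral_withDensity_ofReal {α : Type*} [MeasurableSpace α] {μ : Measure α} {w : α → ℝ}
    (hw : Measurable w) {s : Set α} (hs : MeasurableSet s) (hws : ∀ x ∈ s, 0 ≤ w x) (f : α → ℝ) :
    ∫ x in s, f x ∂μ.withDensity (fun x => ENNReal.ofReal (w x)) = ∫ x in s, w x * f x ∂μ := by
  rw [setIntegral_withDensity_eq_setIntegral_toReal_smul hw.ennreal_ofReal
    (Eventually.of_forall fun _ => ENNReal.ofReal_lt_top) f hs]
  refine setIntegral_congr_fun hs fun x hx => ?_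
  simp only [ENNReal.toReal_ofReal (hws x hx), smul_eq_mul]

theorem integrableOn_withDensity_ofReal_iff {α : Type*} [MeasurableSpace α] {μ : Measure α}
    {w : α → ℝ} (hw : Measurable w) {s : Set α} (hs : MeasurableSet s) (hws : ∀ x ∈ s, 0 ≤ w x)
    {f : α → ℝ} :
    IntegrableOn f s (μ.withDensity fun x => ENNReal.ofReal (w x)) ↔
      IntegrableOn (fun x => w x * f x) s μ := by
  rw [IntegrableOn, restrict_withDensity hs, integrable_withDensity_iff_integrable_smul'
    hw.ennreal_ofReal (Eventually.of_forall fun _ => ENNReal.ofReal_lt_top)]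
  refine integrableOn_congr_fun (fun x hx => ?_) hs
  simp only [ENNReal.toReal_ofReal (hws x hx), smul_eq_mul]

section PeakAtZero

variable {φ : ℝ → ℝ}

theorem integral_neg_deriv_mul_nat_succ_mul_pow (n : ℕ) {a b : ℝ} (hab : a ≤ b)
    (hφ : ContinuousOn φ (Set.Icc a b)) (hdiff : ∀ s ∈ Set.Ioo a b, DifferentiableAt ℝ φ s)
    (hφnn : ∀ s ∈ Set.Ioo a b, 0 ≤ φ s) (hderiv : ∀ s ∈ Set.Ioo a b, deriv φ s ≤ 0) :
    ∫ s in Set.Ioc a b, -deriv φ s * ((n + 1) * φ s ^ n) = φ a ^ (n + 1) - φ b ^ (n + 1) := by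
  have hcont : ContinuousOn (fun s => -φ s ^ (n + 1)) (Set.Icc a b) := (hφ.pow _).neg
  have hpow : ∀ s ∈ Set.Ioo a b, HasDerivAt (fun s => -φ s ^ (n + 1))
      (-deriv φ s * ((n + 1) * φ s ^ n)) s := fun s hs => by
    refine ((hdiff s hs).hasDerivAt.pow (n + 1)).neg.congr_deriv ?_
    push_cast [Nat.add_sub_cancel]
    ring
  have hint := intervalIntegral.integrableOn_deriv_of_nonneg hcont hpow fun s hs =>
    mul_nonneg (neg_nonneg.2 (hderiv s hs)) (mul_nonneg (by positivity) (pow_nonneg (hφnn s hs) n))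
  rw [← intervalIntegral.integral_of_le hab,
    intervalIntegral.integral_eq_sub_of_hasDerivAt_of_le hab hcont hpow
      ((intervalIntegrable_iff_integrableOn_Ioc_of_le hab).2 hint)]
  ring

theorem tendstoUniformlyOn_nat_succ_mul_pow (hφ0 : φ 0 = 1) (hφnn : ∀ s, 0 ≤ s → 0 ≤ φ s)
    (hanti : StrictAntiOn φ (Set.Ici 0)) {U : Set ℝ} (hU : U ∈ 𝓝 0) :
    TendstoUniformlyOn (fun (n : ℕ) s => (n + 1) * φ s ^ n) 0 atTop (Set.Ioi 0 \ U) := by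
  obtain ⟨δ, hδ : 0 < δ, hδU⟩ := mem_nhdsGE_iff_exists_Icc_subset.1 (mem_nhdsWithin_of_mem_nhds hU)
  have hφδ : φ δ < 1 := hφ0 ▸ hanti Set.self_mem_Ici hδ.le hδ
  have hlim : Tendsto (fun n : ℕ => (n + 1) * φ δ ^ n) atTop (𝓝 0) := by
    have h := (tendsto_self_mul_const_pow_of_lt_one (hφnn δ hδ.le) hφδ).add
      (tendsto_pow_atTop_nhds_zero_of_lt_one (hφnn δ hδ.le) hφδ)
    rw [add_zero] at h
    exact h.congr fun n => by ring
  rw [Metric.tendstoUniformlyOn_iff]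
  intro ε hε
  filter_upwards [hlim.eventually (gt_mem_nhds hε)] with n hn s hs
  have hs0 : 0 < s := hs.1
  have hδs : δ ≤ s := not_lt.1 fun h => hs.2 (hδU ⟨hs0.le, h.le⟩)
  have hφs := hφnn s hs0.le
  rw [Pi.zero_apply, dist_zero_left, Real.norm_of_nonneg (by positivity)]
  refine lt_of_le_of_lt ?_ hn
  gcongr
  exact hanti.antitoneOn hδ.le hs0.le hδs

theorem strictAntiOn_Ici_of_deriv_neg (hφ : ContinuousOn φ (Set.Ici 0))
    (hderiv : ∀ s, 0 < s → deriv φ s < 0) : StrictAntiOn φ (Set.Ici 0) :=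
  strictAntiOn_of_deriv_neg (convex_Ici 0) hφ fun s hs => hderiv s (by simpa using hs)

theorem tendsto_integral_neg_deriv_mul_nat_succ_mul_pow (hφ : ContinuousOn φ (Set.Ici 0))
    (hφ0 : φ 0 = 1) (hφnn : ∀ s, 0 ≤ s → 0 ≤ φ s) (hderiv : ∀ s, 0 < s → deriv φ s < 0) :
    Tendsto (fun n : ℕ => ∫ s in Set.Ioc 0 1, -deriv φ s * ((n + 1) * φ s ^ n)) atTop (𝓝 1) := by
  have hφ1 : φ 1 < 1 := (strictAntiOn_Ici_of_deriv_neg hφ hderiv Set.self_mem_Ici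
    (Set.mem_Ici.2 zero_le_one) one_pos).trans_eq hφ0
  have hlim := ((tendsto_add_atTop_iff_nat 1).2
    (tendsto_pow_atTop_nhds_zero_of_lt_one (hφnn 1 zero_le_one) hφ1)).const_sub 1
  rw [sub_zero] at hlim
  refine hlim.congr fun n => ?_
  rw [integral_neg_deriv_mul_nat_succ_mul_pow n zero_le_one (hφ.mono Set.Icc_subset_Ici_self)
    (fun s hs => differentiableAt_of_deriv_ne_zero (hderiv s hs.1).ne)
    (fun s hs => hφnn s hs.1.le) (fun s hs => (hderiv s hs.1).le), hφ0, one_pow]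

theorem tendsto_nat_succ_mul_integral_mul_pow {A : ℝ → ℝ} {R : ℝ}
    (hφ : ContinuousOn φ (Set.Ici 0)) (hφ0 : φ 0 = 1) (hφnn : ∀ s, 0 ≤ s → 0 ≤ φ s)
    (hderiv : ∀ s, 0 < s → deriv φ s < 0) (hA : IntegrableOn A (Set.Ioi 0))
    (hR : Tendsto (fun s => A s / -deriv φ s) (𝓝[>] 0) (𝓝 R)) :
    Tendsto (fun n : ℕ => (n + 1) * ∫ s in Set.Ioi 0, A s * φ s ^ n) atTop (𝓝 R) := by
  have hanti := strictAntiOn_Ici_of_deriv_neg hφ hderiv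
  have hdiff : ∀ s, 0 < s → DifferentiableAt ℝ φ s := fun s hs =>
    differentiableAt_of_deriv_ne_zero (hderiv s hs).ne
  have hφI : ContinuousOn φ (Set.Icc 0 1) := hφ.mono Set.Icc_subset_Ici_self
  have hw : Measurable fun s => -deriv φ s := (measurable_deriv φ).neg
  have hwpos : ∀ s, 0 < s → 0 < -deriv φ s := fun s hs => neg_pos.2 (hderiv s hs)
  -- Against the measure `-φ' ds`, `(n + 1) φ ^ n` is a peak at `0` of mass tending to one.
  set μ : Measure ℝ := volume.withDensity fun s => ENNReal.ofReal (-deriv φ s) with hμ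
  have hintegral : ∀ f : ℝ → ℝ, ∀ T ⊆ Set.Ioi 0, MeasurableSet T →
      ∫ s in T, f s ∂μ = ∫ s in T, -deriv φ s * f s := fun f T hT hTm =>
    setIntegral_withDensity_ofReal hw hTm (fun s hs => (hwpos s (hT hs)).le) f
  have hmass : Tendsto (fun n : ℕ => ∫ s in Set.Ioc 0 1, (n + 1) * φ s ^ n ∂μ) atTop (𝓝 1) := by
    refine (tendsto_integral_neg_deriv_mul_nat_succ_mul_pow hφ hφ0 hφnn hderiv).congr fun n => ?_
    rw [hintegral _ _ Set.Ioc_subset_Ioi_self measurableSet_Ioc]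
  have hfinite : μ (Set.Ioc 0 1) ≠ ⊤ := by
    have hint : IntegrableOn (fun s => -deriv φ s) (Set.Ioc 0 1) :=
      intervalIntegral.integrableOn_deriv_of_nonneg hφI.neg
        (fun s hs => (hdiff s hs.1).hasDerivAt.neg) (fun s hs => (hwpos s hs.1).le)
    rw [hμ, withDensity_apply _ measurableSet_Ioc]
    exact hint.lintegral_lt_top.ne
  have hcancel : ∀ s ∈ Set.Ioi (0 : ℝ), -deriv φ s * (A s / -deriv φ s) = A s := fun s hs =>
    mul_div_cancel₀ _ (hwpos s hs).ne'
  have hquot : IntegrableOn (fun s => A s / -deriv φ s) (Set.Ioi 0) μ :=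
    (integrableOn_withDensity_ofReal_iff hw measurableSet_Ioi fun s hs => (hwpos s hs).le).2
      (hA.congr_fun (fun s hs => (hcancel s hs).symm) measurableSet_Ioi)
  have hpeak := tendsto_setIntegral_peak_smul_of_integrableOn_of_tendsto measurableSet_Ioi
    measurableSet_Ioc Set.Ioc_subset_Ioi_self (Ioc_mem_nhdsGT one_pos) hfinite
    (Eventually.of_forall fun n s (hs : 0 < s) =>
      mul_nonneg (by positivity) (pow_nonneg (hφnn s hs.le) n))
    (fun U hU h0 => tendstoUniformlyOn_nat_succ_mul_pow hφ0 hφnn hanti (hU.mem_nhds h0)) hmass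
    (Eventually.of_forall fun n => (((hφ.mono Set.Ioi_subset_Ici_self).pow n).const_mul
      _).aestronglyMeasurable measurableSet_Ioi) hquot hR
  refine hpeak.congr fun n => ?_
  rw [hintegral _ _ subset_rfl measurableSet_Ioi, ← integral_const_mul]
  refine setIntegral_congr_fun measurableSet_Ioi fun s hs => ?_
  rw [smul_eq_mul, mul_left_comm, hcancel s hs]
  ring

end PeakAtZero

section LaplaceTransform

variable {Ω : Type*} [MeasurableSpace Ω] {P : Measure Ω} {X : Ω → ℝ} {γ s : ℝ}

theorem Iio_zero_subset_interior_integrableExpSet [IsFiniteMeasure P] (hX : AEMeasurable X P)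
    (hX0 : 0 ≤ᵐ[P] X) : Set.Iio 0 ⊆ interior (integrableExpSet X P) := by
  refine interior_maximal (fun t (ht : t < 0) => ?_) isOpen_Iio
  refine Integrable.of_bound (hX.const_mul t).exp.aestronglyMeasurable 1 ?_
  filter_upwards [hX0] with ω hω
  rw [Real.norm_of_nonneg (Real.exp_pos _).le, Real.exp_le_one_iff]
  exact mul_nonpos_of_nonpos_of_nonneg ht.le hω

theorem continuousOn_mgf_neg [IsFiniteMeasure P] (hX : AEMeasurable X P) (hX0 : 0 ≤ᵐ[P] X) :
    ContinuousOn (fun s => mgf X P (-s)) (Set.Ici 0) := by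
  refine continuousOn_of_dominated (bound := fun _ => 1)
    (fun s _ => (hX.const_mul (-s)).exp.aestronglyMeasurable) (fun s (hs : 0 ≤ s) => ?_)
    (integrable_const 1) (Eventually.of_forall fun ω => by fun_prop)
  filter_upwards [hX0] with ω hω
  rw [Real.norm_of_nonneg (Real.exp_pos _).le, Real.exp_le_one_iff, neg_mul]
  exact neg_nonpos.2 (mul_nonneg hs hω)

theorem hasDerivAt_mgf_neg [IsFiniteMeasure P] (hX : AEMeasurable X P) (hX0 : 0 ≤ᵐ[P] X)
    (hs : 0 < s) : HasDerivAt (fun s => mgf X P (-s)) (-dampedMoment P X 1 s) s := by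
  have hmgf := hasDerivAt_mgf (Iio_zero_subset_interior_integrableExpSet hX hX0
    (Set.mem_Iio.2 (neg_lt_zero.2 hs)))
  refine (hmgf.comp s (hasDerivAt_neg s)).congr_deriv ?_
  simp only [dampedMoment, Real.rpow_one, neg_mul, mul_neg_one]

theorem dampedMoment_pos [IsFiniteMeasure P] (hX : AEMeasurable X P) (hX0 : 0 ≤ᵐ[P] X)
    (hXpos : 0 < tailProb P X 0) (hγ : 0 ≤ γ) (hs : 0 < s) : 0 < dampedMoment P X γ s := by
  have hint : Integrable (fun ω => X ω ^ γ * Real.exp (-(s * X ω))) P := by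
    simpa only [neg_mul] using integrable_rpow_mul_exp_of_mem_interior_integrableExpSet
      (Iio_zero_subset_interior_integrableExpSet hX hX0 (Set.mem_Iio.2 (neg_lt_zero.2 hs))) hγ
  have hnn : 0 ≤ᵐ[P] fun ω => X ω ^ γ * Real.exp (-(s * X ω)) :=
    hX0.mono fun ω hω => mul_nonneg (Real.rpow_nonneg hω γ) (Real.exp_pos _).le
  rw [dampedMoment, integral_pos_iff_support_of_nonneg_ae hnn hint]
  refine (ENNReal.toReal_pos_iff.1 hXpos).1.trans_le (measure_mono fun ω (hω : 0 < X ω) => ?_)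
  exact (mul_pos (Real.rpow_pos_of_pos hω γ) (Real.exp_pos _)).ne'

end LaplaceTransform

section GammaRepresentation

variable {Ω : Type*} [MeasurableSpace Ω] {P : Measure Ω} {X S : Ω → ℝ} {γ : ℝ}

theorem integrable_div_rpow [IsFiniteMeasure P] (hX : AEMeasurable X P) (hS : AEMeasurable S P)
    (hX0 : 0 ≤ᵐ[P] X) (hXS : X ≤ᵐ[P] S) (hγ : 0 ≤ γ) :
    Integrable (fun ω => (X ω / S ω) ^ γ) P := by
  refine Integrable.of_bound ((hX.div hS).pow_const γ).aestronglyMeasurable 1 ?_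
  filter_upwards [hX0, hXS] with ω (hω : 0 ≤ X ω) hle
  have hratio : 0 ≤ X ω / S ω := div_nonneg hω (hω.trans hle)
  rw [Real.norm_of_nonneg (Real.rpow_nonneg hratio γ)]
  exact Real.rpow_le_one hratio (div_le_one_of_le₀ hle (hω.trans hle)) hγ

theorem integrableOn_rpow_sub_one_mul_rpow_mul_exp {x S : ℝ} (hx : 0 ≤ x) (hxS : x ≤ S)
    (hγ : 0 < γ) :
    IntegrableOn (fun s => s ^ (γ - 1) * (x ^ γ * Real.exp (-(s * S)))) (Set.Ioi 0) := by
  rcases hx.eq_or_lt with rfl | hx0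
  · simp [Real.zero_rpow hγ.ne']
  · refine IntegrableOn.congr_fun ((integrableOn_rpow_mul_exp_neg_mul_rpow (p := 1) (s := γ - 1)
      (by linarith) one_pos (hx0.trans_le hxS)).const_mul (x ^ γ)) (fun s _ => ?_) measurableSet_Ioi
    rw [Real.rpow_one]
    ring_nf

theorem integral_rpow_sub_one_mul_rpow_mul_exp {x S : ℝ} (hx : 0 ≤ x) (hxS : x ≤ S)
    (hγ : 0 < γ) :
    ∫ s in Set.Ioi 0, s ^ (γ - 1) * (x ^ γ * Real.exp (-(s * S))) = Real.Gamma γ * (x / S) ^ γ := by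
  rcases hx.eq_or_lt with rfl | hx0
  · simp [Real.zero_rpow hγ.ne']
  · simp only [mul_left_comm _ (x ^ γ), mul_comm _ S]
    rw [integral_const_mul, Real.integral_rpow_mul_exp_neg_mul_Ioi hγ (hx0.trans_le hxS),
      one_div, Real.inv_rpow (hx.trans hxS), Real.div_rpow hx (hx.trans hxS)]
    ring

theorem integrable_prod_rpow_sub_one_mul_rpow_mul_exp [IsFiniteMeasure P] (hX : AEMeasurable X P)
    (hS : AEMeasurable S P) (hX0 : 0 ≤ᵐ[P] X) (hXS : X ≤ᵐ[P] S) (hγ : 0 < γ) :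
    Integrable (fun p : Ω × ℝ => p.2 ^ (γ - 1) * (X p.1 ^ γ * Real.exp (-(p.2 * S p.1))))
      (P.prod (volume.restrict (Set.Ioi 0))) := by
  have hmeas : AEMeasurable
      (fun p : Ω × ℝ => p.2 ^ (γ - 1) * (X p.1 ^ γ * Real.exp (-(p.2 * S p.1))))
      (P.prod (volume.restrict (Set.Ioi 0))) :=
    (measurable_snd.pow_const _).aemeasurable.mul ((hX.comp_fst.pow_const γ).mul
      (measurable_snd.aemeasurable.mul hS.comp_fst).neg.exp)
  refine (integrable_prod_iff hmeas.aestronglyMeasurable).2 ⟨?_, ?_⟩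
  · filter_upwards [hX0, hXS] with ω hω hle
    exact integrableOn_rpow_sub_one_mul_rpow_mul_exp hω hle hγ
  · refine ((integrable_div_rpow hX hS hX0 hXS hγ.le).const_mul (Real.Gamma γ)).congr ?_
    filter_upwards [hX0, hXS] with ω hω hle
    rw [← integral_rpow_sub_one_mul_rpow_mul_exp hω hle hγ]
    refine setIntegral_congr_fun measurableSet_Ioi fun s (hs : 0 < s) => ?_
    exact (Real.norm_of_nonneg (mul_nonneg (Real.rpow_nonneg hs.le _)
      (mul_nonneg (Real.rpow_nonneg hω γ) (Real.exp_pos _).le))).symm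

theorem integrableOn_rpow_sub_one_mul_integral_rpow_mul_exp [IsFiniteMeasure P]
    (hX : AEMeasurable X P) (hS : AEMeasurable S P) (hX0 : 0 ≤ᵐ[P] X) (hXS : X ≤ᵐ[P] S)
    (hγ : 0 < γ) :
    IntegrableOn (fun s => s ^ (γ - 1) * ∫ ω, X ω ^ γ * Real.exp (-(s * S ω)) ∂P)
      (Set.Ioi 0) := by
  simpa only [IntegrableOn, integral_const_mul] using
    (integrable_prod_rpow_sub_one_mul_rpow_mul_exp hX hS hX0 hXS hγ).integral_prod_right

theorem integral_rpow_sub_one_mul_integral_rpow_mul_exp [IsFiniteMeasure P]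
    (hX : AEMeasurable X P) (hS : AEMeasurable S P) (hX0 : 0 ≤ᵐ[P] X) (hXS : X ≤ᵐ[P] S)
    (hγ : 0 < γ) :
    ∫ s in Set.Ioi 0, s ^ (γ - 1) * ∫ ω, X ω ^ γ * Real.exp (-(s * S ω)) ∂P =
      Real.Gamma γ * ∫ ω, (X ω / S ω) ^ γ ∂P := by
  simp only [← integral_const_mul]
  rw [← integral_integral_swap (integrable_prod_rpow_sub_one_mul_rpow_mul_exp hX hS hX0 hXS hγ)]
  refine integral_congr_ae ?_
  filter_upwards [hX0, hXS] with ω hω hle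
  exact integral_rpow_sub_one_mul_rpow_mul_exp hω hle hγ

end GammaRepresentation

section SelfNormalizedSum

variable {Ω : Type*} [MeasurableSpace Ω] {P : Measure Ω} {β γ : ℝ}

theorem integral_rpow_mul_exp_neg_add_eq_dampedMoment_mul_mgf {X T : Ω → ℝ} (hX : AEMeasurable X P)
    (hT : AEMeasurable T P) (hXT : X ⟂ᵢ[P] T) (γ s : ℝ) :
    ∫ ω, X ω ^ γ * Real.exp (-(s * (X ω + T ω))) ∂P = dampedMoment P X γ s * mgf T P (-s) := by
  have hindep := hXT.comp (φ := fun x => x ^ γ * Real.exp (-(s * x)))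
    (ψ := fun t => Real.exp (-s * t)) (by fun_prop) (by fun_prop)
  have hprod := hindep.integral_fun_mul_eq_mul_integral
    (((hX.pow_const γ).mul (hX.const_mul s).neg.exp).aestronglyMeasurable)
    (hT.const_mul (-s)).exp.aestronglyMeasurable
  simp only [Function.comp_apply] at hprod
  rw [dampedMoment, mgf, ← hprod]
  refine integral_congr_ae (Eventually.of_forall fun ω => ?_)
  simp only [mul_assoc, ← Real.exp_add]
  ring_nf

theorem integral_rpow_mul_exp_neg_sum_eq_dampedMoment_mul_mgf_pow {ι : Type*}
    {X : ι → Ω → ℝ} (hindep : iIndepFun X P) {i : ι}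
    (hident : ∀ j, IdentDistrib (X j) (X i) P P) {t : Finset ι} (hi : i ∈ t) (γ s : ℝ) :
    ∫ ω, X i ω ^ γ * Real.exp (-(s * ∑ j ∈ t, X j ω)) ∂P =
      dampedMoment P (X i) γ s * mgf (X i) P (-s) ^ (t.card - 1) := by
  classical
  have hX : ∀ j, AEMeasurable (X j) P := fun j => (hident j).aemeasurable_fst
  have hrest := hindep.indepFun_finsetSum_of_notMem₀ hX (Finset.notMem_erase i t)
  have hmgf : mgf (∑ j ∈ t.erase i, X j) P (-s) = mgf (X i) P (-s) ^ (t.card - 1) := by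
    rw [hindep.mgf_sum₀ hX, ← Finset.card_erase_of_mem hi]
    exact Finset.prod_eq_pow_card fun j _ => congr_fun (mgf_congr_identDistrib (hident j)) _
  rw [← hmgf, ← integral_rpow_mul_exp_neg_add_eq_dampedMoment_mul_mgf (hX i)
    (Finset.aemeasurable_sum _ fun j _ => hX j) hrest.symm]
  congr with ω
  rw [Finset.sum_apply, Finset.add_sum_erase t (fun j => X j ω) hi]

theorem ae_le_finsetSum_of_identDistrib {ι : Type*} {X : ι → Ω → ℝ} {i : ι}
    (hident : ∀ j, IdentDistrib (X j) (X i) P P) (hX0 : 0 ≤ᵐ[P] X i) {t : Finset ι} (hi : i ∈ t) :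
    X i ≤ᵐ[P] fun ω => ∑ j ∈ t, X j ω := by
  have hnn : ∀ᵐ ω ∂P, ∀ j ∈ t, 0 ≤ X j ω :=
    (Finset.eventually_all t).2 fun j _ => (hident j).symm.ae_snd measurableSet_Ici hX0
  filter_upwards [hnn] with ω hω
  exact Finset.single_le_sum hω hi

theorem Gamma_mul_integral_div_sum_rpow [IsFiniteMeasure P] {ι : Type*} {X : ι → Ω → ℝ}
    (hindep : iIndepFun X P) {i : ι} (hident : ∀ j, IdentDistrib (X j) (X i) P P)
    (hX0 : 0 ≤ᵐ[P] X i) {t : Finset ι} (hi : i ∈ t) (hγ : 0 < γ) :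
    Real.Gamma γ * ∫ ω, (X i ω / ∑ j ∈ t, X j ω) ^ γ ∂P =
      ∫ s in Set.Ioi 0,
        s ^ (γ - 1) * (dampedMoment P (X i) γ s * mgf (X i) P (-s) ^ (t.card - 1)) := by
  have hX : ∀ j, AEMeasurable (X j) P := fun j => (hident j).aemeasurable_fst
  rw [← integral_rpow_sub_one_mul_integral_rpow_mul_exp (hX i)
    (t.aemeasurable_fun_sum fun j _ => hX j) hX0 (ae_le_finsetSum_of_identDistrib hident hX0 hi) hγ]
  simp only [integral_rpow_mul_exp_neg_sum_eq_dampedMoment_mul_mgf_pow hindep hident hi]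

theorem tendsto_nat_mul_integral_div_sum_rpow [IsProbabilityMeasure P] {X : ℕ → Ω → ℝ}
    (hindep : iIndepFun X P) (hident : ∀ i, IdentDistrib (X i) (X 0) P P) (hX0 : 0 ≤ᵐ[P] X 0)
    (hβ : 0 < β) (hβ1 : β < 1) (hβγ : β < γ) (htail : RegularlyVarying (tailProb P (X 0)) (-β)) :
    Tendsto (fun n : ℕ => (n : ℝ) * ∫ ω, (X 0 ω / ∑ i ∈ Finset.range n, X i ω) ^ γ ∂P) atTop
      (𝓝 (Real.Gamma (γ - β) / (Real.Gamma γ * Real.Gamma (1 - β)))) := by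
  have hγ : 0 < γ := hβ.trans hβγ
  have hX : AEMeasurable (X 0) P := (hident 0).aemeasurable_fst
  have hderiv : ∀ s, 0 < s → deriv (fun s => mgf (X 0) P (-s)) s = -dampedMoment P (X 0) 1 s :=
    fun s hs => (hasDerivAt_mgf_neg hX hX0 hs).deriv
  have hderiv_neg : ∀ s, 0 < s → deriv (fun s => mgf (X 0) P (-s)) s < 0 := fun s hs => by
    rw [hderiv s hs]
    exact neg_neg_of_pos (dampedMoment_pos hX hX0
      (htail.pos_of_antitone (antitone_tailProb (X 0)) 0) zero_le_one hs)
  have hratio : Tendsto (fun s => s ^ (γ - 1) * dampedMoment P (X 0) γ s /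
      -deriv (fun s => mgf (X 0) P (-s)) s) (𝓝[>] 0)
      (𝓝 (Real.Gamma (γ - β) / Real.Gamma (1 - β))) := by
    refine (tendsto_rpow_mul_dampedMoment_div_dampedMoment_one hX hX0 hβ hβ1 hβγ htail).congr' ?_
    filter_upwards [self_mem_nhdsWithin] with s hs
    rw [hderiv s hs, neg_neg]
  have hint : IntegrableOn (fun s => s ^ (γ - 1) * dampedMoment P (X 0) γ s) (Set.Ioi 0) :=
    integrableOn_rpow_sub_one_mul_integral_rpow_mul_exp hX hX hX0 EventuallyLE.rfl hγ
  have hpeak := tendsto_nat_succ_mul_integral_mul_pow (continuousOn_mgf_neg hX hX0)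
    (by simp) (fun s _ => mgf_nonneg) hderiv_neg hint hratio
  rw [← tendsto_add_atTop_iff_nat 1, mul_comm (Real.Gamma γ), ← div_div]
  refine (hpeak.div_const (Real.Gamma γ)).congr fun n => ?_
  have hΓ := Gamma_mul_integral_div_sum_rpow hindep hident hX0
    (Finset.mem_range.2 n.succ_pos) hγ
  rw [Finset.card_range, Nat.succ_sub_one] at hΓ
  rw [div_eq_iff (Real.Gamma_pos_of_pos hγ).ne', mul_assoc, mul_comm _ (Real.Gamma γ), hΓ]
  push_cast
  simp only [mul_assoc]

end SelfNormalizedSum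

theorem abs_selfNormalized_rpow_two_mul {Ω : Type*} (Y : ℕ → Ω → ℝ) (k n : ℕ) (ω : Ω) (γ : ℝ) :
    |selfNormalized Y k n ω| ^ (2 * γ) =
      (Y k ω ^ 2 / ∑ i ∈ Finset.range n, Y i ω ^ 2) ^ γ := by
  rw [Real.rpow_mul (abs_nonneg _), Real.rpow_two, sq_abs, selfNormalized, selfNormalizer, div_pow,
    Real.sq_sqrt (Finset.sum_nonneg fun i _ => sq_nonneg _)]

theorem tailProb_sq {Ω : Type*} [MeasurableSpace Ω] (P : Measure Ω) (X : Ω → ℝ) {x : ℝ}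
    (hx : 0 ≤ x) :
    tailProb P (fun ω => X ω ^ 2) x = tailProb P (fun ω => |X ω|) (x ^ (1 / 2 : ℝ)) := by
  simp only [tailProb, ← Real.sqrt_eq_rpow, Real.sqrt_lt_sqrt_iff hx, ← Real.sqrt_sq_eq_abs]

theorem RegularlyVarying.tailProb_sq_of_abs {Ω : Type*} [MeasurableSpace Ω] {P : Measure Ω}
    {X : Ω → ℝ} {ρ : ℝ} (h : RegularlyVarying (tailProb P fun ω => |X ω|) ρ) :
    RegularlyVarying (tailProb P fun ω => X ω ^ 2) (ρ / 2) := by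
  rw [div_eq_inv_mul, ← one_div]
  refine (h.comp_rpow one_half_pos).congr_isEquivalent (EventuallyEq.isEquivalent ?_)
  filter_upwards [eventually_ge_atTop 0] with x hx
  exact tailProb_sq P X hx

theorem mainTheorem7_general {Ω : Type*} [MeasurableSpace Ω] (P : Measure Ω)
    [IsProbabilityMeasure P] (Y : ℕ → Ω → ℝ) (hindep : iIndepFun Y P)
    (hident : ∀ i, IdentDistrib (Y i) (Y 0) P P)
    (α : ℝ) (hα : α ∈ Set.Ioo (0 : ℝ) 2) (ℓ : ℝ → ℝ) (hℓ : SlowlyVarying ℓ)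
    (htail : (fun x : ℝ => P.real {ω | x < |Y 0 ω|}) ~[atTop] (fun x : ℝ => ℓ x * x ^ (-α)))
    (γ : ℝ) (hγ : α / 2 < γ) :
    (∀ n : ℕ, Integrable (fun ω => |selfNormalized Y 0 n ω| ^ (2 * γ)) P) ∧
      Tendsto (fun n : ℕ => (n : ℝ) * ∫ ω, |selfNormalized Y 0 n ω| ^ (2 * γ) ∂P) atTop
        (𝓝 (Real.Gamma (γ - α / 2) / (Real.Gamma γ * Real.Gamma (1 - α / 2)))) := by
  have hγ0 : 0 < γ := (half_pos hα.1).trans hγ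
  have hsq_indep : iIndepFun (fun i ω => Y i ω ^ 2) P :=
    hindep.comp (fun _ x => x ^ 2) fun _ => measurable_id.pow_const 2
  have hsq_ident : ∀ i, IdentDistrib (fun ω => Y i ω ^ 2) (fun ω => Y 0 ω ^ 2) P P := fun i =>
    (hident i).comp (measurable_id.pow_const 2)
  have hsq_tail : RegularlyVarying (tailProb P fun ω => Y 0 ω ^ 2) (-(α / 2)) := by
    rw [← neg_div]
    exact ((hℓ.regularlyVarying_mul_rpow (-α)).congr_isEquivalent htail).tailProb_sq_of_abs
  have hsq_nonneg : 0 ≤ᵐ[P] fun ω => Y 0 ω ^ 2 := Eventually.of_forall fun ω => sq_nonneg _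
  simp only [abs_selfNormalized_rpow_two_mul]
  refine ⟨fun n => ?_, ?_⟩
  · rcases n with _ | n
    · simp [Real.zero_rpow hγ0.ne']
    · exact integrable_div_rpow (hsq_ident 0).aemeasurable_fst
        (Finset.aemeasurable_fun_sum _ fun i _ => (hsq_ident i).aemeasurable_fst) hsq_nonneg
        (ae_le_finsetSum_of_identDistrib hsq_ident hsq_nonneg (Finset.mem_range.2 n.succ_pos))
        hγ0.le
  · exact tendsto_nat_mul_integral_div_sum_rpow (X := fun i ω => Y i ω ^ 2) hsq_indep hsq_ident
      hsq_nonneg (half_pos hα.1) (by linarith [hα.2]) hγ hsq_tail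

theorem mainTheorem7 {Ω : Type*} [MeasurableSpace Ω] (P : Measure Ω) [IsProbabilityMeasure P]
    (Y : ℕ → Ω → ℝ) (hmeas : ∀ i, Measurable (Y i)) (hindep : iIndepFun Y P)
    (hident : ∀ i, IdentDistrib (Y i) (Y 0) P P)
    (α : ℝ) (hα : α ∈ Set.Ioo (0 : ℝ) 2) (ℓ : ℝ → ℝ) (hℓ : SlowlyVarying ℓ)
    (htail : (fun x : ℝ => P.real {ω | x < |Y 0 ω|}) ~[atTop] (fun x : ℝ => ℓ x * x ^ (-α)))
    (γ : ℝ) (hγ : 1 < γ) :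
    (∀ n : ℕ, Integrable (fun ω => |selfNormalized Y 0 n ω| ^ (2 * γ)) P) ∧
      Tendsto (fun n : ℕ => (n : ℝ) * ∫ ω, |selfNormalized Y 0 n ω| ^ (2 * γ) ∂P) atTop
        (𝓝 (Real.Gamma (γ - α / 2) / (Real.Gamma γ * Real.Gamma (1 - α / 2)))) :=
  mainTheorem7_general P Y hindep hident α hα ℓ hℓ htail γ (by linarith [hα.2])
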